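/- Let $F_n$ be the free group of finite rank $n$, let $M$ be a finite subgroup of $\mathrm{Aut}(F_n)$, and let $G = F_n \rtimes M$ be the split extension (semidirect product) in which $M$ acts on $F_n$ in the natural way. Then $G$ is finitely generated and the conjugacy problem is solvable for $G$: for every finite generating family $g_1,\dots,g_k$ of $G$ there is an algorithm which, given any two words in the letters $g_1^{\pm1},\dots,g_k^{\pm1}$, decides whether the elements of $G$ that they represent are conjugate in $G$. -/

import Mathlib

/-- The element of the group `G` that a word in the letters `g i` and `(g i)⁻¹` represents.
A letter is a pair `(i, b)`: it stands for `g i` if `b = true` and for `(g i)⁻¹` if `b = false`. -/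
def wordValue {G : Type*} [Group G] {k : ℕ} (g : Fin k → G) (w : List (Fin k × Bool)) : G :=
  (w.map fun x => if x.2 then g x.1 else (g x.1)⁻¹).prod

/-- The conjugacy problem for the generators `g` of `G` is decidable: there is an algorithm (a
computable function) that, given any two words in the generators and their inverses, decides
whether the elements of `G` that they represent are conjugate in `G`. -/
def DecidesConjugacy {G : Type*} [Group G] {k : ℕ} (g : Fin k → G) : Prop :=
  ComputablePred fun p : List (Fin k × Bool) × List (Fin k × Bool) =>
    IsConj (wordValue g p.1) (wordValue g p.2)

/-- Dehn's conjugacy problem is solvable for `G`: the group `G` is finitely generated, and for every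
finite generating family the conjugacy of two given words in it is algorithmically decidable. -/
def ConjugacyProblemSolvable (G : Type*) [Group G] : Prop :=
  Group.FG G ∧
    ∀ (k : ℕ) (g : Fin k → G), Subgroup.closure (Set.range g) = ⊤ → DecidesConjugacy g

/-! ### Geometry of the Cayley tree -/

namespace FreeGroup

variable {α : Type*} [DecidableEq α]

/-! Conjugate elements of G have a conjugator of linearly bounded length
(`exists_linear_conjugator_bound`). Conjugacy is thus a finite search over words, each test being an
instance of the word problem, which a normal form solves.

For the bound put e = |M|, so that u^e lies in F_n. If u^e ≠ 1, a conjugator may be changed by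
powers of u^e, and a shortest choice is bounded because the Cayley tree is 0-hyperbolic
(`norm_le_of_minimal`). If u^e = 1, let G act on F_n by (f, t)·y = f t(y). The orbit of 1 under u
has a centre x that u moves a bounded distance, so conjugation by x brings u into a fixed finite
ball, where finitely many pairs remain.

The centre argument needs a metric invariant under G, so lengths are summed over M. By
`bounded_cancellation` geodesics of the tree remain geodesics for this sum up to a constant. -/

theorem IsReduced.norm_mk {L : List (α × Bool)} (h : IsReduced L) : norm (mk L) = L.length := by
  rw [norm, toWord_mk, h.reduce_eq]

theorem isReduced_invRev_append {X Y : List (α × Bool)} (hX : IsReduced X) (hY : IsReduced Y)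
    (h : ∀ l ∈ X.head?, l ∉ Y.head?) : IsReduced (invRev X ++ Y) := by
  have hX' : IsReduced (invRev X) := by
    rw [isReduced_iff_reduce_eq, reduce_invRev, hX.reduce_eq]
  refine List.isChain_append.2 ⟨hX', hY, ?_⟩
  rintro a ha b hb hab
  cases X with
  | nil => simp [invRev] at ha
  | cons c X =>
    have hac : a = (c.1, !c.2) := by simpa [invRev, eq_comm] using ha
    subst hac
    by_contra hne
    refine h c (by simp) ?_
    have : c = b := by
      refine Prod.ext hab ?_
      cases hc : c.2 <;> cases hb' : b.2 <;> simp_all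
    rw [this]
    exact hb

/-- The reduced words of `x` and `y` do not begin with the same letter exactly if the identity lies
on the geodesic from `x` to `y`. -/
theorem norm_inv_mul_eq_add_iff {x y : FreeGroup α} :
    norm (x⁻¹ * y) = norm x + norm y ↔ ∀ l ∈ x.toWord.head?, l ∉ y.toWord.head? := by
  constructor
  · intro h l hx hy
    obtain ⟨X, hX⟩ : ∃ X, x.toWord = l :: X := by
      cases hw : x.toWord with
      | nil => simp [hw] at hx
      | cons c X => simp [hw] at hx; exact ⟨X, by rw [hx]⟩
    obtain ⟨Y, hY⟩ : ∃ Y, y.toWord = l :: Y := by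
      cases hw : y.toWord with
      | nil => simp [hw] at hy
      | cons c X => simp [hw] at hy; exact ⟨X, by rw [hy]⟩
    have hx' : x = mk [l] * mk X := by rw [mul_mk, ← mk_toWord (x := x), hX]; rfl
    have hy' : y = mk [l] * mk Y := by rw [mul_mk, ← mk_toWord (x := y), hY]; rfl
    have h1 : x⁻¹ * y = (mk X)⁻¹ * mk Y := by rw [hx', hy']; group
    have h2 := norm_mul_le (mk X)⁻¹ (mk Y)
    have h3 : norm (mk X) ≤ X.length := norm_mk_le
    have h4 : norm (mk Y) ≤ Y.length := norm_mk_le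
    have h5 : norm x = X.length + 1 := by rw [norm, hX]; rfl
    have h6 : norm y = Y.length + 1 := by rw [norm, hY]; rfl
    rw [norm_inv_eq] at h2
    rw [h1] at h
    omega
  · intro h
    have h1 := (isReduced_invRev_append isReduced_toWord isReduced_toWord h).norm_mk
    rw [← mul_mk, ← inv_mk, mk_toWord, mk_toWord] at h1
    rw [h1, List.length_append, invRev_length]
    rfl

/-- The vertex `z` lies on the geodesic from `x` to `y` in the Cayley tree of the free group. -/
def Btw (x z y : FreeGroup α) : Prop :=
  norm (x⁻¹ * z) + norm (z⁻¹ * y) = norm (x⁻¹ * y)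

theorem norm_inv_mul_comm (x y : FreeGroup α) : norm (x⁻¹ * y) = norm (y⁻¹ * x) := by
  rw [← norm_inv_eq]; simp

theorem norm_inv_mul_triangle (x y z : FreeGroup α) :
    norm (x⁻¹ * z) ≤ norm (x⁻¹ * y) + norm (y⁻¹ * z) := by
  have := norm_mul_le (x⁻¹ * y) (y⁻¹ * z)
  rwa [show x⁻¹ * y * (y⁻¹ * z) = x⁻¹ * z by group] at this

theorem Btw.symm {x z y : FreeGroup α} (h : Btw x z y) : Btw y z x := by
  unfold Btw at *
  rw [norm_inv_mul_comm y z, norm_inv_mul_comm z x, norm_inv_mul_comm y x]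
  omega

/-- A point of the side `[x, y]` of a triangle lies on one of the two other sides. -/
theorem Btw.or {x z y : FreeGroup α} (h : Btw x z y) (w : FreeGroup α) : Btw x z w ∨ Btw y z w := by
  -- Seen from `z`, betweenness says that the directions of `x` and `y` have different first
  -- letters; the direction of `w` cannot share its first letter with both.
  have key (x y : FreeGroup α) : Btw x z y ↔
      norm ((z⁻¹ * x)⁻¹ * (z⁻¹ * y)) = norm (z⁻¹ * x) + norm (z⁻¹ * y) := by
    unfold Btw
    rw [norm_inv_mul_comm x z, show (z⁻¹ * x)⁻¹ * (z⁻¹ * y) = x⁻¹ * y by group, eq_comm]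
  simp only [key, norm_inv_mul_eq_add_iff] at *
  by_contra! hc
  obtain ⟨⟨l, h1, h2⟩, l', h3, h4⟩ := hc
  rw [Option.mem_def] at h1 h2 h3 h4
  rw [h2] at h4
  obtain rfl : l = l' := Option.some_injective _ h4
  exact h l h1 h3

theorem exists_common_prefix (X Y : List (α × Bool)) :
    ∃ p a b, X = p ++ a ∧ Y = p ++ b ∧ ∀ l ∈ a.head?, l ∉ b.head? := by
  induction X generalizing Y with
  | nil => exact ⟨[], [], Y, by simp⟩
  | cons c X ih =>
    cases Y with
    | nil => exact ⟨[], c :: X, [], by simp⟩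
    | cons d Y =>
      by_cases hcd : c = d
      · subst hcd
        obtain ⟨p, a, b, rfl, rfl, h⟩ := ih Y
        exact ⟨c :: p, a, b, rfl, rfl, h⟩
      · refine ⟨[], c :: X, d :: Y, rfl, rfl, ?_⟩
        simpa [eq_comm] using hcd

/-- Any three vertices of the tree have a median. -/
theorem exists_median (x y z : FreeGroup α) : ∃ p, Btw x p y ∧ Btw y p z ∧ Btw x p z := by
  -- The median is where the geodesics from `z` to `x` and to `y` part.
  obtain ⟨p, a, b, ha, hb, hab⟩ := exists_common_prefix (z⁻¹ * x).toWord (z⁻¹ * y).toWord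
  have hra : IsReduced (p ++ a) := ha ▸ isReduced_toWord
  have hrb : IsReduced (p ++ b) := hb ▸ isReduced_toWord
  have hp := hra.infix ⟨[], a, rfl⟩
  have ha' : IsReduced a := hra.infix ⟨p, [], by simp⟩
  have hb' : IsReduced b := hrb.infix ⟨p, [], by simp⟩
  have hx : z⁻¹ * x = mk p * mk a := by rw [mul_mk, ← ha, mk_toWord]
  have hy : z⁻¹ * y = mk p * mk b := by rw [mul_mk, ← hb, mk_toWord]
  have hnx : norm (z⁻¹ * x) = p.length + a.length := by rw [norm, ha, List.length_append]
  have hny : norm (z⁻¹ * y) = p.length + b.length := by rw [norm, hb, List.length_append]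
  have hzx : z⁻¹ * (z * mk p) = mk p := by group
  have hxm : norm ((z * mk p)⁻¹ * x) = a.length := by
    rw [← ha'.norm_mk, show (z * mk p)⁻¹ * x = (mk p)⁻¹ * (z⁻¹ * x) by group, hx, inv_mul_cancel_left]
  have hym : norm ((z * mk p)⁻¹ * y) = b.length := by
    rw [← hb'.norm_mk, show (z * mk p)⁻¹ * y = (mk p)⁻¹ * (z⁻¹ * y) by group, hy, inv_mul_cancel_left]
  have hxy : norm (x⁻¹ * y) = a.length + b.length := by
    rw [show x⁻¹ * y = (z⁻¹ * x)⁻¹ * (z⁻¹ * y) by group, hx, hy,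
      show (mk p * mk a)⁻¹ * (mk p * mk b) = (mk a)⁻¹ * mk b by group, norm_inv_mul_eq_add_iff.2,
      ha'.norm_mk, hb'.norm_mk]
    rwa [toWord_mk, toWord_mk, ha'.reduce_eq, hb'.reduce_eq]
  refine ⟨z * mk p, ?_, Btw.symm ?_, Btw.symm ?_⟩
  · rw [Btw, hym, norm_inv_mul_comm, hxm, hxy]
  · rw [Btw, hym, hny, hzx, hp.norm_mk]
  · rw [Btw, hxm, hnx, hzx, hp.norm_mk]

/-- The four-point condition: the Cayley graph of a free group is `0`-hyperbolic. -/
theorem four_point (x y z w : FreeGroup α) :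
    norm (x⁻¹ * y) + norm (z⁻¹ * w) ≤
      max (norm (x⁻¹ * z) + norm (y⁻¹ * w)) (norm (x⁻¹ * w) + norm (y⁻¹ * z)) := by
  obtain ⟨p, hxy, hyz, hxz⟩ := exists_median x y z
  have t1 := norm_inv_mul_triangle x p w
  have t2 := norm_inv_mul_triangle y p w
  have t3 := norm_inv_mul_triangle z p w
  have c1 := norm_inv_mul_comm p y
  have c2 := norm_inv_mul_comm p z
  have c3 := norm_inv_mul_comm p x
  -- From `w`, at least two of `x`, `y`, `z` are reached through the median.
  have key : ∀ {a b : FreeGroup α}, Btw a p b → norm (a⁻¹ * p) + norm (p⁻¹ * w) = norm (a⁻¹ * w) ∨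
    norm (b⁻¹ * p) + norm (p⁻¹ * w) = norm (b⁻¹ * w) := fun h => h.or w
  have k1 := key hxy
  have k2 := key hyz
  have k3 := key hxz
  unfold Btw at hxy hyz hxz
  omega

theorem exists_midpoint (x y : FreeGroup α) :
    ∃ z, Btw x z y ∧ norm (x⁻¹ * y) ≤ 2 * norm (x⁻¹ * z) + 1 ∧
      norm (x⁻¹ * y) ≤ 2 * norm (y⁻¹ * z) + 1 := by
  set L := (x⁻¹ * y).toWord with hL
  have hr : IsReduced L := isReduced_toWord
  have hn : norm (x⁻¹ * y) = L.length := rfl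
  set p := L.take (L.length / 2)
  set q := L.drop (L.length / 2)
  have hpq : p ++ q = L := List.take_append_drop _ _
  have hp : IsReduced p := hr.infix ⟨[], q, hpq⟩
  have hq : IsReduced q := hr.infix ⟨p, [], by simpa using hpq⟩
  have h1 : norm (x⁻¹ * (x * mk p)) = p.length := by
    rw [← hp.norm_mk]; congr 1; group
  have h2 : norm ((x * mk p)⁻¹ * y) = q.length := by
    rw [← hq.norm_mk]; congr 1
    have : x⁻¹ * y = mk p * mk q := by rw [mul_mk, hpq, hL, mk_toWord]
    rw [show (x * mk p)⁻¹ * y = (mk p)⁻¹ * (x⁻¹ * y) by group, this]; group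
  have hlp : p.length = L.length / 2 := by simp [p]; omega
  have hlq : q.length = L.length - L.length / 2 := by simp [q]
  refine ⟨x * mk p, ?_, ?_, ?_⟩
  · rw [Btw, h1, h2, hn]; omega
  · rw [h1, hn]; omega
  · rw [norm_inv_mul_comm y, h2, hn]; omega

/-- Squaring u = c r c⁻¹, with r cyclically reduced, lengthens it by exactly |r|. -/
theorem eq_one_of_norm_mul_self_le {u : FreeGroup α} (h : norm (u * u) ≤ norm u) : u = 1 := by
  have h2 := congrArg List.length (reduceCyclically.reduce_flatten_replicate_succ
    (isReduced_toWord (x := u)) 1)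
  have h1 := congrArg List.length (reduceCyclically.conj_conjugator_reduceCyclically u.toWord)
  rw [← toWord_pow] at h2
  rw [← pow_two] at h
  unfold norm at h
  simp [List.replicate_succ] at h2 h1
  have h3 : (reduceCyclically u.toWord) = [] := List.eq_nil_of_length_eq_zero (by omega)
  have h4 := reduceCyclically.conj_conjugator_reduceCyclically u.toWord
  rw [h3] at h4
  have h5 := congrArg mk h4
  rw [← mul_mk, ← mul_mk, ← inv_mk, mk_toWord] at h5
  rw [← h5, ← one_eq_mk]
  group

/-- If `f` is shortest in `f⟨u⟩`, then `f` is controlled by `u` and its conjugate `f u f⁻¹`. -/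
theorem norm_le_of_minimal {u f : FreeGroup α} (hu : u ≠ 1) (h1 : norm f ≤ norm (f * u))
    (h2 : norm f ≤ norm (f * u⁻¹)) : norm f ≤ norm u + norm (f * u * f⁻¹) := by
  -- The first four-point inequality forces |fu| = |fu⁻¹| = |f|; the second then gives |u²| ≤ |u|,
  -- hence u = 1.
  by_contra! hc
  have e1 := four_point 1 (f * u)⁻¹ f⁻¹ u⁻¹
  have e2 := four_point f⁻¹ 1 u u⁻¹
  have r1 : norm ((f * u)⁻¹⁻¹ * u⁻¹) = norm f := by congr 1; group
  have r2 : norm ((f * u)⁻¹⁻¹ * f⁻¹) = norm (f * u * f⁻¹) := by congr 1; group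
  have r3 : norm (f⁻¹⁻¹ * u⁻¹) = norm (f * u⁻¹) := by congr 1; group
  have r4 : norm (u⁻¹ * u⁻¹) = norm (u * u) := by rw [← norm_inv_eq]; simp
  have r5 : norm (f⁻¹⁻¹ * u) = norm (f * u) := by congr 1; group
  have r6 : norm (1⁻¹ * (f * u)⁻¹) = norm (f * u) := by rw [← norm_inv_eq]; congr 1; group
  have r7 : norm (1⁻¹ * f⁻¹) = norm f := by rw [← norm_inv_eq]; congr 1; group
  have r8 : norm (1⁻¹ * u⁻¹) = norm u := by rw [← norm_inv_eq]; congr 1; group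
  have r9 : norm (1⁻¹ * u) = norm u := by congr 1; group
  have r10 : norm (f⁻¹⁻¹ * 1) = norm f := by congr 1; group
  rw [r1, r2, r3, r6, r7, r8] at e1
  rw [r3, r4, r5, r8, r9, r10] at e2
  have : ¬ norm (u * u) ≤ norm u := fun h => hu (eq_one_of_norm_mul_self_le h)
  omega

end FreeGroup

/-! ### Bounded cancellation -/

namespace FreeGroup

theorem map_mk_eq_prod {α H : Type*} [Group H] (g : FreeGroup α →* H) (L : List (α × Bool)) :
    g (mk L) = (L.map fun c => g (mk [c])).prod := by
  induction L with
  | nil => rw [← one_eq_mk]; simp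
  | cons c L ih =>
    rw [List.map_cons, List.prod_cons, ← ih, ← _root_.map_mul, mul_mk]; rfl

variable {α : Type*} [DecidableEq α]

/-- A path with steps of length at most `K` in a tree passes within `K` of each vertex between its
end points. -/
theorem exists_near_of_btw {K : ℕ} {A q : FreeGroup α} (l : List (FreeGroup α)) (w : FreeGroup α)
    (hl : ∀ x ∈ l, norm x ≤ K) (hA : Btw w A q) (hq : w * l.prod = q) :
    ∃ i, norm ((w * (l.take i).prod)⁻¹ * A) ≤ K := by
  induction l generalizing w with
  | nil =>
    have hwq : w = q := by simpa using hq
    subst hwq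
    refine ⟨0, ?_⟩
    have : norm (w⁻¹ * A) = 0 := by
      simp only [Btw, inv_mul_cancel, norm_one] at hA
      omega
    simp [this]
  | cons c l ih =>
    have hc : norm c ≤ K := hl c (by simp)
    rcases hA.symm.or (w * c) with h | h
    · obtain ⟨i, hi⟩ := ih (w * c) (fun x hx => hl x (by simp [hx])) h.symm
        (by rw [← hq, List.prod_cons, mul_assoc])
      refine ⟨i + 1, ?_⟩
      rwa [List.take_succ_cons, List.prod_cons, ← mul_assoc]
    · refine ⟨0, ?_⟩
      have h' : norm (w⁻¹ * (w * c)) = norm c := by congr 1; group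
      rw [Btw, h'] at h
      simp only [List.take_zero, List.prod_nil, mul_one]
      omega

/-- The images of the prefixes of `a` form a path from 1 to `g a` with steps of length at most `K`;
`a₁` is the prefix whose image comes near `A`. -/
theorem exists_split_near (g : FreeGroup α →* FreeGroup α) {K : ℕ}
    (hK : ∀ c : α × Bool, norm (g (mk [c])) ≤ K) {a A : FreeGroup α} (h : Btw 1 A (g a)) :
    ∃ a₁ a₂, a = a₁ * a₂ ∧ norm a = norm a₁ + norm a₂ ∧ norm ((g a₁)⁻¹ * A) ≤ K := by
  obtain ⟨i, hi⟩ := exists_near_of_btw (K := K) (A := A) (q := g a)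
    (a.toWord.map fun c => g (mk [c])) 1 (fun x hx => by obtain ⟨c, -, rfl⟩ := List.mem_map.1 hx; exact hK c) h
    (by rw [one_mul, ← map_mk_eq_prod, mk_toWord])
  have hr : IsReduced (a.toWord.take i ++ a.toWord.drop i) := by
    rw [List.take_append_drop]; exact isReduced_toWord
  have h1 : IsReduced (a.toWord.take i) := hr.infix ⟨[], _, rfl⟩
  have h2 : IsReduced (a.toWord.drop i) := hr.infix ⟨_, [], by rw [List.append_nil]⟩
  refine ⟨mk (a.toWord.take i), mk (a.toWord.drop i), ?_, ?_, ?_⟩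
  · rw [mul_mk, List.take_append_drop, mk_toWord]
  · rw [h1.norm_mk, h2.norm_mk, ← List.length_append, List.take_append_drop, norm]
  · rwa [one_mul, ← List.map_take, ← map_mk_eq_prod] at hi

theorem norm_map_le (g : FreeGroup α →* FreeGroup α) {K : ℕ}
    (hK : ∀ c : α × Bool, norm (g (mk [c])) ≤ K) (a : FreeGroup α) : norm (g a) ≤ K * norm a := by
  suffices h : ∀ L, norm (g (mk L)) ≤ K * L.length by
    have := h a.toWord
    rwa [mk_toWord] at this
  intro L
  rw [map_mk_eq_prod]
  induction L with
  | nil => simp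
  | cons c L ih =>
    rw [List.map_cons, List.prod_cons, List.length_cons, mul_add, mul_one]
    have h1 := norm_mul_le (g (mk [c])) (L.map fun c => g (mk [c])).prod
    have h2 := hK c
    omega

theorem exists_norm_letter_le [Finite α] (g : FreeGroup α →* FreeGroup α) :
    ∃ K, ∀ c : α × Bool, norm (g (mk [c])) ≤ K := by
  obtain ⟨K, hK⟩ := (Set.finite_range fun c : α × Bool => norm (g (mk [c]))).bddAbove
  exact ⟨K, fun c => hK ⟨c, rfl⟩⟩

/-- Cooper's bounded cancellation lemma: an automorphism of a free group of finite rank maps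
geodesics to almost geodesics. -/
theorem bounded_cancellation [Finite α] (g : FreeGroup α ≃* FreeGroup α) :
    ∃ C, ∀ x z y, Btw x z y →
      norm (g (x⁻¹ * z)) + norm (g (z⁻¹ * y)) ≤ norm (g (x⁻¹ * y)) + C := by
  obtain ⟨K, hK⟩ := exists_norm_letter_le g.toMonoidHom
  obtain ⟨L, hL⟩ := exists_norm_letter_le g.symm.toMonoidHom
  refine ⟨2 * (K + K * (L * (2 * K))), fun x z y h => ?_⟩
  unfold Btw at h
  rw [show x⁻¹ * y = x⁻¹ * z * (z⁻¹ * y) by group] at h ⊢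
  generalize x⁻¹ * z = a at h ⊢
  generalize z⁻¹ * y = b at h ⊢
  -- The cancellation between `g a` and `g b` is twice the distance from `g a` to the median `p`.
  -- The image paths of `a` and of `b` both pass near `p`, so the piece `g (a₂ * b₁)` joining them
  -- is short.
  obtain ⟨p, h1, h2, h3⟩ := exists_median (g a) (g (a * b)) 1
  obtain ⟨a₁, a₂, ha, hna, hpa⟩ := exists_split_near g.toMonoidHom hK h3.symm
  have h2' : Btw 1 ((g a)⁻¹ * p) (g b) := by
    rw [Btw, show (1 : FreeGroup α)⁻¹ * ((g a)⁻¹ * p) = (g a)⁻¹ * p by group,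
      show ((g a)⁻¹ * p)⁻¹ * g b = p⁻¹ * g (a * b) by rw [_root_.map_mul]; group, h1]
    congr 1; rw [_root_.map_mul]; group
  obtain ⟨b₁, b₂, hb, hnb, hpb⟩ := exists_split_near g.toMonoidHom hK h2'
  change norm ((g a₁)⁻¹ * p) ≤ K at hpa
  change norm ((g b₁)⁻¹ * ((g a)⁻¹ * p)) ≤ K at hpb
  have e1 : norm (g (a₂ * b₁)) ≤ 2 * K := by
    have := norm_inv_mul_triangle (g a₁) p (g (a * b₁))
    rw [norm_inv_mul_comm p] at this
    rw [show (g a₁)⁻¹ * g (a * b₁) = g (a₂ * b₁) by rw [ha, _root_.map_mul, _root_.map_mul, _root_.map_mul]; group,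
      show (g (a * b₁))⁻¹ * p = (g b₁)⁻¹ * ((g a)⁻¹ * p) by rw [_root_.map_mul]; group] at this
    omega
  have e2 : norm (a₂ * b₁) ≤ L * (2 * K) := by
    have := norm_map_le g.symm.toMonoidHom hL (g (a₂ * b₁))
    change norm (g.symm (g (a₂ * b₁))) ≤ _ at this
    rw [MulEquiv.symm_apply_apply] at this
    exact this.trans (Nat.mul_le_mul_left _ e1)
  -- Nothing cancels in `a * b`, so `a₂` is no longer than `a₂ * b₁`, which is short because
  -- `g.symm` is Lipschitz.
  have e3 : norm a₂ ≤ norm (a₂ * b₁) := by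
    have t1 := norm_mul_le a₁ (a₂ * b₁ * b₂)
    have t2 := norm_mul_le (a₂ * b₁) b₂
    rw [show a₁ * (a₂ * b₁ * b₂) = a * b by rw [ha, hb]; group] at t1
    omega
  have e4 : norm (g a₂) ≤ K * (L * (2 * K)) :=
    (norm_map_le g.toMonoidHom hK a₂).trans (Nat.mul_le_mul_left _ (e3.trans e2))
  have e5 : norm ((g a)⁻¹ * p) ≤ K + K * (L * (2 * K)) := by
    have := norm_inv_mul_triangle (g a) (g a₁) p
    rw [norm_inv_mul_comm (g a) (g a₁),
      show (g a₁)⁻¹ * g a = g a₂ by rw [ha, _root_.map_mul]; group] at this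
    omega
  have e6 := norm_inv_mul_comm p (g a)
  have e9 := norm_inv_mul_comm p (g (a * b))
  have e7 : norm ((g a)⁻¹ * g (a * b)) = norm (g b) := by rw [_root_.map_mul]; congr 1; group
  have e8 : ∀ w : FreeGroup α, norm (w⁻¹ * 1) = norm w := fun w => by rw [mul_one, norm_inv_eq]
  unfold Btw at h1 h2 h3
  rw [e7] at h1
  rw [e8, e8] at h2 h3
  omega

end FreeGroup

/-! ### Invariant lengths and the linear bound on conjugators -/

namespace FreeGroup

variable {α : Type*} [DecidableEq α] (M : Subgroup (MulAut (FreeGroup α))) [Fintype M]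

/-- The sum of the lengths of the images of `f` under the automorphisms in `M`. -/
def orbitNorm (f : FreeGroup α) : ℕ :=
  ∑ t : M, norm ((t : MulAut (FreeGroup α)) f)

variable {M}

theorem orbitNorm_mul_le (a b : FreeGroup α) :
    orbitNorm M (a * b) ≤ orbitNorm M a + orbitNorm M b := by
  unfold orbitNorm
  rw [← Finset.sum_add_distrib]
  exact Finset.sum_le_sum fun t _ => by rw [_root_.map_mul]; exact norm_mul_le _ _

theorem orbitNorm_inv (a : FreeGroup α) : orbitNorm M a⁻¹ = orbitNorm M a := by
  unfold orbitNorm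
  exact Finset.sum_congr rfl fun t _ => by rw [_root_.map_inv, norm_inv_eq]

theorem orbitNorm_one : orbitNorm M (1 : FreeGroup α) = 0 := by
  simp [orbitNorm]

theorem orbitNorm_apply (s : M) (a : FreeGroup α) :
    orbitNorm M ((s : MulAut (FreeGroup α)) a) = orbitNorm M a := by
  unfold orbitNorm
  exact Fintype.sum_equiv (Equiv.mulRight s) _ _ fun t => by simp

theorem norm_le_orbitNorm (a : FreeGroup α) : norm a ≤ orbitNorm M a := by
  have := Finset.single_le_sum (f := fun t : M => norm ((t : MulAut (FreeGroup α)) a))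
    (fun _ _ => Nat.zero_le _) (Finset.mem_univ 1)
  simp only [OneMemClass.coe_one, MulAut.one_apply] at this
  exact this

theorem orbitNorm_bounded_cancellation [Finite α] :
    ∃ C, ∀ x z y : FreeGroup α, Btw x z y →
      orbitNorm M (x⁻¹ * z) + orbitNorm M (z⁻¹ * y) ≤ orbitNorm M (x⁻¹ * y) + C := by
  choose C hC using fun t : M => bounded_cancellation (t : MulAut (FreeGroup α))
  refine ⟨∑ t, C t, fun x z y h => ?_⟩
  unfold orbitNorm
  rw [← Finset.sum_add_distrib, ← Finset.sum_add_distrib]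
  exact Finset.sum_le_sum fun t _ => hC t x z y h

/-- A length function on the semidirect product which vanishes on `M`. -/
def sdNorm (u : FreeGroup α ⋊[M.subtype] M) : ℕ := orbitNorm M u.left

theorem sdNorm_mul_le (u v : FreeGroup α ⋊[M.subtype] M) :
    sdNorm (u * v) ≤ sdNorm u + sdNorm v := by
  have := orbitNorm_mul_le (M := M) u.left ((u.right : MulAut (FreeGroup α)) v.left)
  rwa [orbitNorm_apply] at this

theorem sdNorm_one : sdNorm (1 : FreeGroup α ⋊[M.subtype] M) = 0 := orbitNorm_one

theorem sdNorm_inl (f : FreeGroup α) :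
    sdNorm (SemidirectProduct.inl f : FreeGroup α ⋊[M.subtype] M) = orbitNorm M f := rfl

theorem sdNorm_inr (t : M) :
    sdNorm (SemidirectProduct.inr t : FreeGroup α ⋊[M.subtype] M) = 0 := orbitNorm_one

theorem sdNorm_inv (u : FreeGroup α ⋊[M.subtype] M) : sdNorm u⁻¹ = sdNorm u := by
  have := orbitNorm_apply (M := M) u.right⁻¹ u.left⁻¹
  rw [orbitNorm_inv] at this
  exact this

theorem sdNorm_pow_le (u : FreeGroup α ⋊[M.subtype] M) (n : ℕ) : sdNorm (u ^ n) ≤ n * sdNorm u := by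
  induction n with
  | zero => simp [sdNorm_one]
  | succ n ih =>
    have := sdNorm_mul_le (u ^ n) u
    rw [pow_succ, add_mul, one_mul]
    omega

theorem norm_left_le_sdNorm (u : FreeGroup α ⋊[M.subtype] M) : norm u.left ≤ sdNorm u :=
  norm_le_orbitNorm _

/-- This is the invariant distance from `x` to `u.left`, the image of 1 under `u`. -/
theorem sdNorm_inl_inv_mul (x : FreeGroup α) (u : FreeGroup α ⋊[M.subtype] M) :
    sdNorm ((SemidirectProduct.inl x)⁻¹ * u) = orbitNorm M (x⁻¹ * u.left) := by
  rw [← _root_.map_inv, sdNorm, SemidirectProduct.mul_left]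
  simp

/-- Elements of finite order can be conjugated into a bounded ball by short elements of the free
group. -/
theorem exists_conj_bounded_of_torsion [Finite α] :
    ∃ C, ∀ (u : FreeGroup α ⋊[M.subtype] M) (e : ℕ), 0 < e → u ^ e = 1 →
      ∃ x : FreeGroup α, sdNorm (SemidirectProduct.inl x : FreeGroup α ⋊[M.subtype] M) ≤
          e * sdNorm u ∧
        norm ((SemidirectProduct.inl x)⁻¹ * u * SemidirectProduct.inl x).left ≤ C := by
  obtain ⟨C, hC⟩ := orbitNorm_bounded_cancellation (M := M)
  refine ⟨2 * C + 1, fun u e he hu => ?_⟩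
  -- `P r`: some ball of radius `r` contains the orbit of 1 under `u`. Below, `r` is minimal and `x`
  -- is a centre; its image `x'` under `u` is another, as the orbit is invariant.
  let P : ℕ → Prop := fun r => ∃ x : FreeGroup α, ∀ i : ℤ, orbitNorm M (x⁻¹ * (u ^ i).left) ≤ r
  have hP : P (e * sdNorm u) := by
    refine ⟨1, fun i => ?_⟩
    have hi : u ^ i = u ^ (i % e).toNat := by
      rw [← zpow_natCast u, Int.toNat_of_nonneg (Int.emod_nonneg _ (by omega)),
        Int.emod_def, zpow_sub, zpow_mul, zpow_natCast, hu]
      simp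
    rw [inv_one, one_mul, hi]
    refine (sdNorm_pow_le _ _).trans (Nat.mul_le_mul_right _ ?_)
    have := Int.emod_lt_of_pos i (show (0 : ℤ) < e by omega)
    omega
  classical
  have hex : ∃ r, P r := ⟨_, hP⟩
  obtain ⟨x, hx⟩ := Nat.find_spec hex
  have hle : Nat.find hex ≤ e * sdNorm u := Nat.find_min' hex hP
  have hmin : ∀ r, P r → Nat.find hex ≤ r := fun r hr => Nat.find_min' hex hr
  generalize Nat.find hex = r at hx hle hmin
  refine ⟨x, ?_, ?_⟩
  · rw [sdNorm_inl, ← orbitNorm_inv]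
    have := hx 0
    rw [zpow_zero, SemidirectProduct.one_left, mul_one] at this
    omega
  set x' := (u * SemidirectProduct.inl x).left with hx'
  have hux : u * SemidirectProduct.inl x =
      SemidirectProduct.inl x' * SemidirectProduct.inr u.right := by
    rw [← SemidirectProduct.inl_left_mul_inr_right (u * SemidirectProduct.inl x)]
    simp [hx']
  have hxx' : ((SemidirectProduct.inl x)⁻¹ * u * SemidirectProduct.inl x).left = x⁻¹ * x' := by
    rw [mul_assoc, ← _root_.map_inv, SemidirectProduct.mul_left]
    simp [hx']
  have hx1 : ∀ i : ℤ, orbitNorm M (x'⁻¹ * (u ^ i).left) ≤ r := fun i => by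
    have h1 : (SemidirectProduct.inl x')⁻¹ * u ^ i =
        SemidirectProduct.inr u.right * ((SemidirectProduct.inl x)⁻¹ * u ^ (i - 1)) := by
      have h2 : (SemidirectProduct.inl x' : FreeGroup α ⋊[M.subtype] M) =
          u * SemidirectProduct.inl x * (SemidirectProduct.inr u.right)⁻¹ := by
        rw [hux, mul_inv_cancel_right]
      rw [h2, zpow_sub_one, ← (Commute.refl u).zpow_right i |>.inv_left.eq]
      group
    rw [← sdNorm_inl_inv_mul, h1]
    refine (sdNorm_mul_le _ _).trans ?_
    rw [sdNorm_inr, sdNorm_inl_inv_mul, zero_add]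
    exact hx _
  rw [hxx']
  -- If the centres are more than 2C + 1 apart, their midpoint is at least C + 1 from each, and
  -- bounded cancellation makes it the centre of a smaller ball.
  by_contra! hlt
  obtain ⟨z, hz, hz1, hz2⟩ := exists_midpoint x x'
  have key : ∀ i : ℤ, orbitNorm M (z⁻¹ * (u ^ i).left) + 1 ≤ r := fun i => by
    have n1 := norm_le_orbitNorm (M := M) (x⁻¹ * z)
    have n2 := norm_le_orbitNorm (M := M) (x'⁻¹ * z)
    rcases hz.or (u ^ i).left with h | h
    · have c := hC _ _ _ h
      have b := hx i
      omega
    · have c := hC _ _ _ h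
      have b := hx1 i
      omega
  have k0 := key 0
  have := hmin (r - 1) ⟨z, fun i => by have := key i; omega⟩
  omega

/-- Conjugate elements of infinite order are conjugate by an element of linearly bounded length. -/
theorem exists_short_conj_of_pow_ne_one {u v x : FreeGroup α ⋊[M.subtype] M}
    (h : x * u * x⁻¹ = v) {e : ℕ} (he : (u ^ e).right = 1) (hu : u ^ e ≠ 1) :
    ∃ y, y * u * y⁻¹ = v ∧ norm y.left ≤ e * (sdNorm u + sdNorm v) := by
  set t : FreeGroup α ⋊[M.subtype] M := SemidirectProduct.inr x.right with ht
  set w := t * u * t⁻¹ with hw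
  have hwe : w ^ e = t * u ^ e * t⁻¹ := conj_pow
  set U := (w ^ e).left with hUdef
  have hU : w ^ e = SemidirectProduct.inl U := by
    have : (w ^ e).right = 1 := by
      rw [hwe, SemidirectProduct.mul_right, SemidirectProduct.mul_right, he]; simp
    rw [← SemidirectProduct.inl_left_mul_inr_right (w ^ e), this, _root_.map_one, mul_one]
  have hU1 : U ≠ 1 := by
    intro h1
    rw [h1, _root_.map_one, hwe] at hU
    exact hu (conj_eq_one_iff.1 hU)
  have hwnorm : sdNorm w ≤ sdNorm u := by
    have h1 := sdNorm_mul_le (t * u) t⁻¹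
    have h2 := sdNorm_mul_le t u
    rw [sdNorm_inv, ← hw] at h1
    have h3 : sdNorm t = 0 := sdNorm_inr _
    omega
  have hv : SemidirectProduct.inl x.left * w * (SemidirectProduct.inl x.left)⁻¹ = v := by
    rw [← h]
    nth_rewrite 3 4 [← SemidirectProduct.inl_left_mul_inr_right x]
    rw [hw, ht]; group
  -- `U` is a power of `w`, so a factor `U ^ i` does not affect the conjugate of `w`; choose it to
  -- make the conjugator shortest.
  obtain ⟨i, hi⟩ : ∃ i : ℤ, ∀ j : ℤ, norm (x.left * U ^ i) ≤ norm (x.left * U ^ j) :=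
    ⟨Function.argmin (fun i : ℤ => norm (x.left * U ^ i)),
      fun j => Function.argmin_le (fun i : ℤ => norm (x.left * U ^ i)) j⟩
  set f := x.left * U ^ i with hf
  have hfv : SemidirectProduct.inl f * w * (SemidirectProduct.inl f)⁻¹ = v := by
    have hc : Commute (SemidirectProduct.inl (U ^ i)) w := by
      rw [map_zpow, ← hU]
      exact ((Commute.refl w).pow_left e).zpow_left i
    rw [← hv, hf, _root_.map_mul, mul_assoc (SemidirectProduct.inl x.left), hc.eq]
    group
  have hV : v ^ e = SemidirectProduct.inl (f * U * f⁻¹) := by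
    rw [← hfv, conj_pow, hU]; simp
  have hfn : norm f ≤ norm U + norm (f * U * f⁻¹) := by
    refine norm_le_of_minimal hU1 ?_ ?_
    · have := hi (i + 1)
      rwa [zpow_add_one, ← mul_assoc] at this
    · have := hi (i - 1)
      rwa [zpow_sub_one, ← mul_assoc] at this
  refine ⟨SemidirectProduct.inl f * t, ?_, ?_⟩
  · rw [← hfv, hw]; group
  · have hl : (SemidirectProduct.inl f * t).left = f := by
      rw [ht, SemidirectProduct.mul_left]; simp
    have n1 : norm U ≤ e * sdNorm u := (norm_left_le_sdNorm _).trans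
      ((sdNorm_pow_le _ _).trans (Nat.mul_le_mul_left _ hwnorm))
    have n2 : norm (f * U * f⁻¹) ≤ e * sdNorm v := by
      have := (norm_left_le_sdNorm (v ^ e)).trans (sdNorm_pow_le _ _)
      rwa [hV, SemidirectProduct.left_inl] at this
    rw [hl, mul_add]
    omega

theorem finite_norm_left_le [Finite α] (C : ℕ) :
    {u : FreeGroup α ⋊[M.subtype] M | norm u.left ≤ C}.Finite := by
  have h : ({L : List (α × Bool) | L.length ≤ C} ×ˢ (Set.univ : Set M)).Finite :=
    (List.finite_length_le _ C).prod Set.finite_univ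
  refine Set.Finite.of_injOn
    (f := fun u : FreeGroup α ⋊[M.subtype] M => (u.left.toWord, u.right)) ?_ ?_ h
  · exact fun u hu => ⟨hu, trivial⟩
  intro u _ v _ huv
  rw [Prod.mk.injEq, toWord_inj] at huv
  exact SemidirectProduct.ext huv.1 huv.2

/-- Conjugate elements are conjugate by an element of linearly bounded length. -/
theorem exists_linear_conjugator_bound [Finite α] :
    ∃ A, ∀ u v : FreeGroup α ⋊[M.subtype] M, IsConj u v →
      ∃ y, y * u * y⁻¹ = v ∧ norm y.left ≤ A * (sdNorm u + sdNorm v + 1) := by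
  obtain ⟨C, hC⟩ := exists_conj_bounded_of_torsion (M := M)
  set S := {u : FreeGroup α ⋊[M.subtype] M | norm u.left ≤ C}
  obtain ⟨B, hB⟩ : ∃ B, ∀ s ∈ S, ∀ s' ∈ S, IsConj s s' → ∃ z, z * s * z⁻¹ = s' ∧ sdNorm z ≤ B := by
    have hfin : (S ×ˢ S).Finite := (finite_norm_left_le C).prod (finite_norm_left_le C)
    have hz : ∀ p : (FreeGroup α ⋊[M.subtype] M) × (FreeGroup α ⋊[M.subtype] M), ∃ z,
        IsConj p.1 p.2 → z * p.1 * z⁻¹ = p.2 := fun p => by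
      by_cases hp : IsConj p.1 p.2
      · obtain ⟨z, hz⟩ := isConj_iff.1 hp
        exact ⟨z, fun _ => hz⟩
      · exact ⟨1, fun h => absurd h hp⟩
    choose z hz using hz
    obtain ⟨B, hB⟩ := (hfin.image fun p => sdNorm (z p)).bddAbove
    exact ⟨B, fun s hs s' hs' h => ⟨z (s, s'), hz (s, s') h, hB ⟨(s, s'), ⟨hs, hs'⟩, rfl⟩⟩⟩
  refine ⟨Fintype.card M + B, fun u v huv => ?_⟩
  obtain ⟨x, hx⟩ := isConj_iff.1 huv
  have hcard : 0 < Fintype.card M := Fintype.card_pos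
  by_cases hu : u ^ Fintype.card M = 1
  · have hv : v ^ Fintype.card M = 1 := by rw [← hx, conj_pow, hu]; simp
    obtain ⟨a, ha, haC⟩ := hC u _ hcard hu
    obtain ⟨b, hb, hbC⟩ := hC v _ hcard hv
    obtain ⟨z, hz, hzB⟩ := hB _ haC _ hbC (by
      refine isConj_iff.2 ⟨(SemidirectProduct.inl b)⁻¹ * x * SemidirectProduct.inl a, ?_⟩
      rw [← hx]; group)
    refine ⟨SemidirectProduct.inl b * z * (SemidirectProduct.inl a)⁻¹, ?_, ?_⟩
    · calc _ = SemidirectProduct.inl b * (z * ((SemidirectProduct.inl a)⁻¹ * u *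
            SemidirectProduct.inl a) * z⁻¹) * (SemidirectProduct.inl b)⁻¹ := by group
        _ = v := by rw [hz]; group
    · refine (norm_left_le_sdNorm _).trans ?_
      have h1 := sdNorm_mul_le (SemidirectProduct.inl b * z) (SemidirectProduct.inl a)⁻¹
      have h2 := sdNorm_mul_le (SemidirectProduct.inl b) z
      rw [sdNorm_inv] at h1
      nlinarith [Nat.zero_le (B * (sdNorm u + sdNorm v))]
  · obtain ⟨y, hy, hyn⟩ := exists_short_conj_of_pow_ne_one hx (e := Fintype.card M) (by
      have : (u ^ Fintype.card M).right = u.right ^ Fintype.card M :=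
        map_pow SemidirectProduct.rightHom u _
      rw [this, pow_card_eq_one]) hu
    refine ⟨y, hy, hyn.trans ?_⟩
    exact Nat.mul_le_mul (Nat.le_add_right _ _) (Nat.le_add_right _ _)

end FreeGroup

/-! ### From lengths of elements to lengths of words -/

namespace FreeGroup

theorem lift_mk_eq_wordValue {G : Type*} [Group G] {k : ℕ} (g : Fin k → G)
    (w : List (Fin k × Bool)) : lift g (mk w) = wordValue g w := by
  rw [lift_mk, wordValue]
  congr 1
  exact List.map_congr_left fun x _ => by cases x.2 <;> rfl

theorem wordValue_append {G : Type*} [Group G] {k : ℕ} (g : Fin k → G)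
    (w w' : List (Fin k × Bool)) : wordValue g (w ++ w') = wordValue g w * wordValue g w' := by
  simp [wordValue]

theorem exists_wordValue_eq {G : Type*} [Group G] {k : ℕ} {g : Fin k → G}
    (hg : Subgroup.closure (Set.range g) = ⊤) (x : G) : ∃ w, wordValue g w = x := by
  have hx : x ∈ (lift g).range := by rw [range_lift_eq_closure, hg]; trivial
  obtain ⟨y, hy⟩ := hx
  refine ⟨y.toWord, ?_⟩
  rw [← lift_mk_eq_wordValue, mk_toWord, hy]

theorem semidirectProduct_fg {α H : Type*} [Finite α] [Group H] [Finite H]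
    (φ : H →* MulAut (FreeGroup α)) : Group.FG (FreeGroup α ⋊[φ] H) := by
  set S : Set (FreeGroup α ⋊[φ] H) :=
    Set.range (fun a => SemidirectProduct.inl (of a)) ∪ Set.range SemidirectProduct.inr
  refine Group.fg_iff.2 ⟨S, ?_, (Set.finite_range _).union (Set.finite_range _)⟩
  refine eq_top_iff.2 fun x _ => ?_
  rw [← SemidirectProduct.inl_left_mul_inr_right x]
  refine mul_mem ?_ (Subgroup.subset_closure (Or.inr ⟨_, rfl⟩))
  have h : (⊤ : Subgroup (FreeGroup α)) ≤ (Subgroup.closure S).comap SemidirectProduct.inl := by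
    rw [← closure_range_of, Subgroup.closure_le]
    rintro _ ⟨a, rfl⟩
    exact Subgroup.subset_closure (Or.inl ⟨a, rfl⟩)
  exact h trivial

variable {α : Type*} [DecidableEq α] {M : Subgroup (MulAut (FreeGroup α))}

/-- Substitute a fixed word for each letter of the free part and one for each element of `M`; the
latter accounts for the `+ 1`. -/
theorem exists_short_wordValue_eq [Finite α] [Finite M] {k : ℕ}
    {g : Fin k → FreeGroup α ⋊[M.subtype] M} (hg : Subgroup.closure (Set.range g) = ⊤) :
    ∃ K, ∀ x, ∃ w, wordValue g w = x ∧ w.length ≤ K * (norm x.left + 1) := by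
  choose V hV using exists_wordValue_eq hg
  let W : α × Bool → List (Fin k × Bool) := fun c => V (SemidirectProduct.inl (mk [c]))
  obtain ⟨K₁, hK₁⟩ := (Set.finite_range fun c => (W c).length).bddAbove
  obtain ⟨K₂, hK₂⟩ :=
    (Set.finite_range fun t : M => (V (SemidirectProduct.inr t)).length).bddAbove
  refine ⟨K₁ + K₂, fun x =>
    ⟨x.left.toWord.flatMap W ++ V (SemidirectProduct.inr x.right), ?_, ?_⟩⟩
  · have h : ∀ L, wordValue g (L.flatMap W) = SemidirectProduct.inl (mk L) := fun L => by
      rw [map_mk_eq_prod]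
      induction L with
      | nil => rfl
      | cons c L ih =>
        rw [List.flatMap_cons, wordValue_append, ih, List.map_cons, List.prod_cons, hV]
    rw [wordValue_append, h, hV, mk_toWord, SemidirectProduct.inl_left_mul_inr_right]
  · have h : ∀ L : List (α × Bool), (L.flatMap W).length ≤ K₁ * L.length := fun L => by
      induction L with
      | nil => simp
      | cons c L ih =>
        have := hK₁ ⟨c, rfl⟩
        simp only at this
        rw [List.flatMap_cons, List.length_append, List.length_cons, mul_add]
        omega
    have h1 := h x.left.toWord
    have h2 := hK₂ ⟨x.right, rfl⟩
    simp only at h2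
    rw [List.length_append]
    have h3 : K₁ * x.left.toWord.length = K₁ * norm x.left := rfl
    nlinarith [Nat.zero_le (K₂ * norm x.left)]

theorem exists_sdNorm_wordValue_le [Fintype M] {k : ℕ} (g : Fin k → FreeGroup α ⋊[M.subtype] M) :
    ∃ K, ∀ w, sdNorm (wordValue g w) ≤ K * w.length := by
  obtain ⟨K, hK⟩ := (Set.finite_range fun i => sdNorm (g i)).bddAbove
  refine ⟨K, fun w => ?_⟩
  induction w with
  | nil => exact sdNorm_one.le
  | cons c w ih =>
    have h1 : wordValue g (c :: w) = (if c.2 then g c.1 else (g c.1)⁻¹) * wordValue g w := by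
      simp [wordValue]
    have h2 : sdNorm (if c.2 then g c.1 else (g c.1)⁻¹) ≤ K := by
      have := hK ⟨c.1, rfl⟩
      split_ifs
      · exact this
      · rwa [sdNorm_inv]
    have h3 := sdNorm_mul_le (if c.2 then g c.1 else (g c.1)⁻¹) (wordValue g w)
    rw [h1, List.length_cons, mul_add]
    omega

/-- Words that represent conjugate elements are conjugate by a word of linearly bounded length. -/
theorem exists_isConj_wordValue_bound [Finite α] [Finite M] {k : ℕ}
    {g : Fin k → FreeGroup α ⋊[M.subtype] M} (hg : Subgroup.closure (Set.range g) = ⊤) :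
    ∃ A, ∀ w w', IsConj (wordValue g w) (wordValue g w') →
      ∃ x : List (Fin k × Bool), x.length ≤ A * (w.length + w'.length + 1) ∧
        wordValue g (x ++ w) = wordValue g (w' ++ x) := by
  cases nonempty_fintype M
  obtain ⟨A, hA⟩ := exists_linear_conjugator_bound (M := M)
  obtain ⟨K, hK⟩ := exists_short_wordValue_eq hg
  obtain ⟨B, hB⟩ := exists_sdNorm_wordValue_le g
  refine ⟨K * (A * (B + 1) + 1), fun w w' h => ?_⟩
  obtain ⟨y, hy, hyn⟩ := hA _ _ h
  obtain ⟨x, hx, hxl⟩ := hK y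
  refine ⟨x, hxl.trans ?_, ?_⟩
  · rw [mul_assoc]
    refine Nat.mul_le_mul_left _ ?_
    have h1 := hB w
    have h2 := hB w'
    have h3 : sdNorm (wordValue g w) + sdNorm (wordValue g w') + 1 ≤
        (B + 1) * (w.length + w'.length + 1) := by nlinarith
    have h4 := Nat.mul_le_mul_left A h3
    nlinarith
  · rw [wordValue_append, wordValue_append, hx, ← hy]; group

end FreeGroup

/-! ### Computability of the normal form and of the search -/

namespace FreeGroup

theorem primrec_reduce {α : Type*} [DecidableEq α] [Primcodable α] :
    Primrec (reduce : List (α × Bool) → List (α × Bool)) := by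
  have hcons : Primrec₂ fun (_ : List (α × Bool)) (p : (α × Bool) × List (α × Bool)) =>
      (List.casesOn p.2 [p.1] fun hd tl =>
        if p.1.1 = hd.1 ∧ p.1.2 = !hd.2 then tl else p.1 :: hd :: tl : List (α × Bool)) := by
    refine Primrec.list_casesOn (Primrec.snd.comp Primrec.snd)
      (Primrec.list_cons.comp (Primrec.fst.comp Primrec.snd) (Primrec.const []))
      (h := fun (q : List (α × Bool) × ((α × Bool) × List (α × Bool)))
        (r : (α × Bool) × List (α × Bool)) =>
        if q.2.1.1 = r.1.1 ∧ q.2.1.2 = !r.1.2 then r.2 else q.2.1 :: r.1 :: r.2) ?_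
    have hl : Primrec fun a : (List (α × Bool) × ((α × Bool) × List (α × Bool))) ×
        ((α × Bool) × List (α × Bool)) => a.1.2.1 :=
      Primrec.fst.comp (Primrec.snd.comp Primrec.fst)
    have hr : Primrec fun a : (List (α × Bool) × ((α × Bool) × List (α × Bool))) ×
        ((α × Bool) × List (α × Bool)) => a.2.1 := Primrec.fst.comp Primrec.snd
    have ht : Primrec fun a : (List (α × Bool) × ((α × Bool) × List (α × Bool))) ×
        ((α × Bool) × List (α × Bool)) => a.2.2 := Primrec.snd.comp Primrec.snd
    refine Primrec.ite (PrimrecPred.and ?_ ?_) ht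
      (Primrec.list_cons.comp hl (Primrec.list_cons.comp hr ht))
    · exact Primrec.eq.comp (Primrec.fst.comp hl) (Primrec.fst.comp hr)
    · exact Primrec.eq.comp (Primrec.snd.comp hl) (Primrec.not.comp (Primrec.snd.comp hr))
  refine (Primrec.list_foldr Primrec.id (Primrec.const []) hcons).of_eq fun L => ?_
  induction L with
  | nil => rfl
  | cons c L ih =>
    rw [reduce.cons, ← ih]; rfl

/-- All words over the alphabet `letters` of length at most `l`. -/
def wordsUpTo {β : Type*} (letters : List β) (l : ℕ) : List (List β) :=
  Nat.rec [[]] (fun _ W => W ++ W.flatMap fun w => letters.map fun c => c :: w) l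

theorem mem_wordsUpTo {β : Type*} {letters : List β} (h : ∀ c, c ∈ letters) (w : List β) {l : ℕ}
    (hw : w.length ≤ l) : w ∈ wordsUpTo letters l := by
  induction l generalizing w with
  | zero =>
    rw [List.eq_nil_of_length_eq_zero (Nat.le_zero.1 hw)]
    exact List.mem_singleton.2 rfl
  | succ l ih =>
    refine List.mem_append.2 ?_
    cases w with
    | nil => exact Or.inl (ih [] (Nat.zero_le _))
    | cons c w =>
      exact Or.inr (List.mem_flatMap.2
        ⟨w, ih w (Nat.le_of_succ_le_succ hw), List.mem_map.2 ⟨c, h c, rfl⟩⟩)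

theorem primrec_wordsUpTo {β : Type*} [Primcodable β] (letters : List β) :
    Primrec (wordsUpTo letters) := by
  refine Primrec.nat_rec₁ _ ?_
  refine Primrec.list_append.comp Primrec.snd (Primrec.list_flatMap Primrec.snd ?_)
  refine Primrec.list_map (Primrec.const letters) ?_
  exact Primrec.list_cons.comp Primrec.snd (Primrec.snd.comp Primrec.fst)

variable {n : ℕ} {M : Subgroup (MulAut (FreeGroup (Fin n)))}

/-- The words in a finite family of elements of the semidirect product have a primitive recursive
normal form. -/
theorem exists_primrec_normalForm [Finite M] {k : ℕ}
    (g : Fin k → FreeGroup (Fin n) ⋊[M.subtype] M) :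
    ∃ (m : ℕ) (N : List (Fin k × Bool) → List (Fin n × Bool) × Fin m), Primrec N ∧
      ∀ w w', wordValue g w = wordValue g w' ↔ N w = N w' := by
  let m := Nat.card M
  let ε : M ≃ Fin m := Finite.equivFin M
  let h : Fin k × Bool → FreeGroup (Fin n) ⋊[M.subtype] M :=
    fun c => if c.2 then g c.1 else (g c.1)⁻¹
  let T : (Fin k × Bool) × (Fin n × Bool) → List (Fin n × Bool) :=
    fun p => ((h p.1).right.1 (mk [p.2])).toWord
  let R : (Fin k × Bool) × Fin m → Fin m := fun p => ε ((h p.1).right * ε.symm p.2)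
  -- By (a, s)(f, t) = (a s(f), st), multiplying by a letter on the left only needs the finite
  -- tables `T` and `R`. The free part stays unreduced until the end.
  let E : List (Fin k × Bool) → List (Fin n × Bool) × Fin m := fun w =>
    w.foldr (fun c s => ((h c).left.toWord ++ s.1.flatMap (fun d => T (c, d)), R (c, s.2)))
      ([], ε 1)
  have hE : Primrec E := by
    refine Primrec.list_foldr Primrec.id (Primrec.const ([], ε 1)) (h := fun _ p =>
      ((h p.1).left.toWord ++ p.2.1.flatMap (fun d => T (p.1, d)), R (p.1, p.2.2))) ?_
    have hc : Primrec fun a : List (Fin k × Bool) × ((Fin k × Bool) ×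
        (List (Fin n × Bool) × Fin m)) => a.2.1 := Primrec.fst.comp Primrec.snd
    have hs : Primrec fun a : List (Fin k × Bool) × ((Fin k × Bool) ×
        (List (Fin n × Bool) × Fin m)) => a.2.2 := Primrec.snd.comp Primrec.snd
    refine Primrec.pair (Primrec.list_append.comp ?_ (Primrec.list_flatMap ?_ ?_)) ?_
    · exact (Primrec.dom_finite fun c => (h c).left.toWord).comp hc
    · exact Primrec.fst.comp hs
    · exact (Primrec.dom_finite T).comp (Primrec.pair (hc.comp Primrec.fst) Primrec.snd)
    · exact (Primrec.dom_finite R).comp (Primrec.pair hc (Primrec.snd.comp hs))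
  have hval : ∀ w, (wordValue g w).left = mk (E w).1 ∧ (wordValue g w).right = ε.symm (E w).2 := by
    intro w
    induction w with
    | nil => exact ⟨one_eq_mk, by simp [E, wordValue]⟩
    | cons c w ih =>
      have h1 : wordValue g (c :: w) = h c * wordValue g w := by simp [wordValue, h]
      have h2 : E (c :: w) = ((h c).left.toWord ++ (E w).1.flatMap (fun d => T (c, d)),
        R (c, (E w).2)) := rfl
      have h3 : ∀ L : List (Fin n × Bool),
          mk (L.flatMap fun d => T (c, d)) = (h c).right.1 (mk L) := fun L => by
        induction L with
        | nil => rw [← one_eq_mk, _root_.map_one]; rfl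
        | cons d L ihL =>
          rw [List.flatMap_cons, ← mul_mk, ihL, mk_toWord, ← _root_.map_mul, mul_mk]; rfl
      rw [h1, h2]
      constructor
      · rw [SemidirectProduct.mul_left, ← mul_mk, mk_toWord, h3, ih.1]; rfl
      · rw [SemidirectProduct.mul_right, ih.2]; simp [R]
  refine ⟨m, fun w => (reduce (E w).1, (E w).2),
    Primrec.pair (primrec_reduce.comp (Primrec.fst.comp hE)) (Primrec.snd.comp hE),
    fun w w' => ?_⟩
  rw [SemidirectProduct.ext_iff, (hval w).1, (hval w').1, (hval w).2, (hval w').2, Prod.mk.injEq,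
    ε.symm.injective.eq_iff, ← toWord_inj, toWord_mk, toWord_mk]

theorem decidesConjugacy [Finite M] {k : ℕ} {g : Fin k → FreeGroup (Fin n) ⋊[M.subtype] M}
    (hg : Subgroup.closure (Set.range g) = ⊤) : DecidesConjugacy g := by
  obtain ⟨A, hA⟩ := exists_isConj_wordValue_bound hg
  obtain ⟨m, N, hN, hNeq⟩ := exists_primrec_normalForm g
  let letters : List (Fin k × Bool) := Finset.univ.toList
  have hletters : ∀ c, c ∈ letters := fun c => by simp [letters]
  have hrel : PrimrecRel fun (x : List (Fin k × Bool))
      (p : List (Fin k × Bool) × List (Fin k × Bool)) => N (x ++ p.1) = N (p.2 ++ x) :=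
    Primrec.eq.comp
      (hN.comp (Primrec.list_append.comp Primrec.fst (Primrec.fst.comp Primrec.snd)))
      (hN.comp (Primrec.list_append.comp (Primrec.snd.comp Primrec.snd) Primrec.fst))
  have hbound : Primrec fun p : List (Fin k × Bool) × List (Fin k × Bool) =>
      wordsUpTo letters (A * (p.1.length + p.2.length + 1)) :=
    (primrec_wordsUpTo letters).comp (Primrec.nat_mul.comp (Primrec.const A)
      (Primrec.succ.comp (Primrec.nat_add.comp (Primrec.list_length.comp Primrec.fst)
        (Primrec.list_length.comp Primrec.snd))))
  -- Any `x` that is found gives a conjugator; the bound only ensures that the search misses none.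
  -- `A` is a fixed number, so its mere existence suffices.
  have hpred := hrel.exists_mem_list.comp hbound Primrec.id
  refine (PrimrecPred.of_eq hpred fun p => ?_).computablePred
  constructor
  · rintro ⟨x, -, hx⟩
    rw [id, ← hNeq, wordValue_append, wordValue_append] at hx
    exact isConj_iff.2 ⟨wordValue g x, by rw [hx, mul_inv_cancel_right]⟩
  · intro h
    obtain ⟨x, hxl, hx⟩ := hA p.1 p.2 h
    exact ⟨x, mem_wordsUpTo hletters x hxl, (hNeq _ _).1 hx⟩

end FreeGroup

theorem proposition4p1 (n : ℕ) (M : Subgroup (MulAut (FreeGroup (Fin n)))) [Finite M] :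
    ConjugacyProblemSolvable (FreeGroup (Fin n) ⋊[M.subtype] M) :=
  ⟨FreeGroup.semidirectProduct_fg M.subtype, fun _ _ hg => FreeGroup.decidesConjugacy hg⟩
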